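/- Let $E$ be a linear subspace of $\mathbb{R}^d$ with orthogonal complement $E^\perp$, let $P_E$ be the orthogonal projection onto $E$, and let $\mu,\nu$ be Borel probability measures on $\mathbb{R}^d$ with finite second moments. Put $\mu_E=(P_E)_\sharp\mu$ and $\nu_E=(P_E)_\sharp\nu$, and let $(\mu_{x_E})_{x_E\in E}$, $(\nu_{y_E})_{y_E\in E}$ be disintegrations of $\mu$ and $\nu$ on $E$, i.e. regular conditional laws on $E^\perp$ of the $E^\perp$-component given the $E$-component. Let $S:E\to E$ be a Borel map with $S_\sharp\mu_E=\nu_E$ (for example a Monge map from $\mu_E$ to $\nu_E$) which is injective on a set of full $\mu_E$-measure. Let $$\Pi_E(\mu,\nu)=\{\gamma\in\Pi(\mu,\nu):\ (P_E,P_E)_\sharp\gamma=(\mathrm{Id},S)_\sharp\mu_E\}$$ be the set of $E$-optimal plans, where $\Pi(\mu,\nu)$ is the set of couplings of $\mu$ and $\nu$. A Monge-Knothe plan is the law $\pi_{\mathrm{MK}}$ of $(x_E+a,\;S(x_E)+b)$, where $x_E\sim\mu_E$ and, given $x_E$, $(a,b)$ has law $\kappa_{x_E}$, for a measurable family $(\kappa_{x_E})_{x_E\in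 E}$ of probability measures on $E^\perp\times E^\perp$ such that for $\mu_E$-almost every $x_E$, $\kappa_{x_E}$ is a coupling of $\mu_{x_E}$ and $\nu_{S(x_E)}$ of least quadratic cost among all their couplings. Then: 1. A Monge-Knothe plan exists. 2. Every Monge-Knothe plan $\pi_{\mathrm{MK}}$ belongs to $\Pi_E(\mu,\nu)$ and has finite and minimal quadratic cost there: $$\pi_{\mathrm{MK}}\in\operatorname*{arg\,min}_{\gamma\in\Pi_E(\mu,\nu)}\ \mathbb{E}_{(X,Y)\sim\gamma}\big[\|X-Y\|^2\big].$$ 3. Let $\hat T:E\times E^\perp\to E^\perp$ be a Borel map such that, for $\mu_E$-almost every $x_E$, $\hat T(x_E;\cdot)$ is a Monge map from $\mu_{x_E}$ to $\nu_{S(x_E)}$, i.e. it pushes $\mu_{x_E}$ forward to $\nu_{S(x_E)}$ and $(\mathrm{Id},\hat T(x_E;\cdot))_\sharp\mu_{x_E}$ has least quadratic cost among all couplings of $\mu_{x_E}$ and $\nu_{S(x_E)}$. Put $T_{\mathrm{MK}}(x)=S(x_E)+\hat T(x_E;x_{E^\perp})$ for $x=x_E+x_{E^\perp}$. Then the plan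 $(\mathrm{Id},T_{\mathrm{MK}})_\sharp\mu$ also belongs to $\Pi_E(\mu,\nu)$ and has finite and minimal quadratic cost there. -/

import Mathlib

open MeasureTheory ProbabilityTheory
open scoped ENNReal

noncomputable section

namespace SubspaceDetour

/-! ### Couplings, quadratic cost, optimal couplings, Monge maps -/

/-- `γ` is a transportation plan (coupling) between `μ` and `ν`. -/
def IsCoupling {X Y : Type*} [MeasurableSpace X] [MeasurableSpace Y]
    (γ : Measure (X × Y)) (μ : Measure X) (ν : Measure Y) : Prop :=
  γ.map Prod.fst = μ ∧ γ.map Prod.snd = ν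

/-- The quadratic transport cost, the expectation of `‖X - Y‖ ^ 2` for `(X, Y)` of law `γ`,
with values in `[0, ∞]`. -/
def transportCost {X : Type*} [NormedAddCommGroup X] [MeasurableSpace X]
    (γ : Measure (X × X)) : ℝ≥0∞ :=
  ∫⁻ p, ‖p.1 - p.2‖ₑ ^ 2 ∂γ

/-- `γ` is a coupling of `μ` and `ν` of least quadratic cost among all couplings. -/
def IsOptimalCoupling {X : Type*} [NormedAddCommGroup X] [MeasurableSpace X]
    (γ : Measure (X × X)) (μ ν : Measure X) : Prop :=
  IsCoupling γ μ ν ∧ ∀ γ' : Measure (X × X), IsCoupling γ' μ ν → transportCost γ ≤ transportCost γ'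

/-- `T` is a (Borel) transportation map from `μ` to `ν`. -/
def IsTransportMap {X Y : Type*} [MeasurableSpace X] [MeasurableSpace Y]
    (T : X → Y) (μ : Measure X) (ν : Measure Y) : Prop :=
  Measurable T ∧ μ.map T = ν

/-- `T` is a Monge map from `μ` to `ν`: a transportation map whose plan `(Id, T)_♯ μ` is an
optimal coupling of `μ` and `ν`. -/
def IsMongeMap {X : Type*} [NormedAddCommGroup X] [MeasurableSpace X]
    (T : X → X) (μ ν : Measure X) : Prop :=
  IsTransportMap T μ ν ∧ IsOptimalCoupling (μ.map fun x => (x, T x)) μ ν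

/-! ### Projection on a subspace and disintegration -/

variable {d : ℕ} (E : Submodule ℝ (EuclideanSpace ℝ (Fin d)))

/-- `μ_E`, the image of `μ` under the orthogonal projection onto `E`. -/
def projMeasure (μ : Measure (EuclideanSpace ℝ (Fin d))) : Measure E :=
  μ.map fun x => E.orthogonalProjectionOnto x

/-- `γ_E`, the image of `γ` under the orthogonal projection onto `E` of both coordinates. -/
def projPlan (γ : Measure (EuclideanSpace ℝ (Fin d) × EuclideanSpace ℝ (Fin d))) :
    Measure (E × E) :=
  γ.map fun p => (E.orthogonalProjectionOnto p.1, E.orthogonalProjectionOnto p.2)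

/-- The Markov kernel `κ`, that is `x_E ↦ μ_{x_E}`, is a disintegration of `μ` on `E`: the
conditional law of the component in `Eᗮ` given the component `x_E` in `E`. -/
structure IsDisintegration (μ : Measure (EuclideanSpace ℝ (Fin d))) (κ : Kernel E Eᗮ) : Prop where
  markov : IsMarkovKernel κ
  eq_compProd :
    μ.map (fun x => (E.orthogonalProjectionOnto x, Eᗮ.orthogonalProjectionOnto x)) =
      projMeasure E μ ⊗ₘ κ

/-! ### Subspace-optimal plans and the Monge-Knothe plan -/

/-- `Π_E(μ, ν)`: the couplings `γ` of `μ` and `ν` with `γ_E = (Id, S)_♯ μ_E`. -/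
def subspaceOptimalPlans (S : E → E) (μ ν : Measure (EuclideanSpace ℝ (Fin d))) :
    Set (Measure (EuclideanSpace ℝ (Fin d) × EuclideanSpace ℝ (Fin d))) :=
  {γ | IsCoupling γ μ ν ∧ projPlan E γ = (projMeasure E μ).map fun x => (x, S x)}

/-- The plan `κ_{x_E} ⊗ (Id, S)_♯ μ_E`: the law of `(x_E + a, S x_E + b)` where `x_E` has law `μ_E`
and `(a, b)` has law `κ x_E` given `x_E`. -/
def liftPlan (S : E → E) (μ : Measure (EuclideanSpace ℝ (Fin d))) (κ : Kernel E (Eᗮ × Eᗮ)) :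
    Measure (EuclideanSpace ℝ (Fin d) × EuclideanSpace ℝ (Fin d)) :=
  (projMeasure E μ ⊗ₘ κ).map fun p =>
    ((p.1 : EuclideanSpace ℝ (Fin d)) + (p.2.1 : EuclideanSpace ℝ (Fin d)),
      (S p.1 : EuclideanSpace ℝ (Fin d)) + (p.2.2 : EuclideanSpace ℝ (Fin d)))

/-- `π` is a Monge-Knothe plan: it is obtained from `(Id, S)_♯ μ_E` by coupling optimally the
conditionals `κμ x_E = μ_{x_E}` and `κν (S x_E) = ν_{S x_E}`, for `μ_E`-almost every `x_E`. -/
def IsMongeKnothePlan (S : E → E) (μ : Measure (EuclideanSpace ℝ (Fin d)))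
    (κμ κν : Kernel E Eᗮ)
    (π : Measure (EuclideanSpace ℝ (Fin d) × EuclideanSpace ℝ (Fin d))) : Prop :=
  ∃ κ : Kernel E (Eᗮ × Eᗮ), IsMarkovKernel κ ∧
    (∀ᵐ x ∂(projMeasure E μ), IsOptimalCoupling (κ x) (κμ x) (κν (S x))) ∧
    π = liftPlan E S μ κ

/-- The Monge-Knothe map `(x_E, x_{Eᗮ}) ↦ (S x_E, T x_E x_{Eᗮ})`. -/
def mongeKnotheMap (S : E → E) (T : E → Eᗮ → Eᗮ) (x : EuclideanSpace ℝ (Fin d)) :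
    EuclideanSpace ℝ (Fin d) :=
  (S (E.orthogonalProjectionOnto x) : EuclideanSpace ℝ (Fin d)) +
    (T (E.orthogonalProjectionOnto x) (Eᗮ.orthogonalProjectionOnto x) : EuclideanSpace ℝ (Fin d))

end SubspaceDetour

end

/-! By Pythagoras the quadratic cost of a plan is its cost along `E` plus its cost along `Eᗮ`. On
`Π_E(μ, ν)` the first term is fixed by the projected plan. The second is the integral over `x_E` of
the cost of the conditional law `η x_E` of the two `Eᗮ`-components
(`transportCost_eq_of_fiberProj`). Since `S` is essentially injective, `η x_E` must couple `μ_{x_E}`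
and `ν_{S x_E}` (`exists_kernel_of_mem_subspaceOptimalPlans`), so optimal fiberwise couplings
minimize the integral. Finiteness comes from the second moments, and a Monge-Knothe map induces a
Monge-Knothe plan.

Existence needs optimal couplings chosen measurably in `x_E`. On a compact space, couplings are cut
out of the compact space of probability measures by countably many continuous equations, and
minimizing lower semicontinuous functions preserves measurability of correspondences. Minimizing a
separating sequence in turn leaves a single point, which is the selection. Euclidean space reduces
to this case by a projective compactification. -/

namespace SubspaceDetour

open Filter TopologicalSpace
open scoped NNReal Topology

/-! ### Measurable selection in compact spaces -/

section Selection

variable {X P R : Type*} [MeasurableSpace X] [TopologicalSpace P]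

/-- A closed-valued correspondence `C` such that every closed set is hit by `C x` for a measurable
set of parameters `x`. -/
structure IsMeasurableCorrespondence (C : X → Set P) : Prop where
  isClosed : ∀ x, IsClosed (C x)
  measurableSet : ∀ F, IsClosed F → MeasurableSet {x | (C x ∩ F).Nonempty}

/-- The minimizers of `f` in `C x`. -/
def argminCorrespondence [LE R] (f : P → R) (C : X → Set P) (x : X) : Set P :=
  {p ∈ C x | ∀ q ∈ C x, f p ≤ f q}

lemma isMeasurableCorrespondence_univ : IsMeasurableCorrespondence fun _ : X => (Set.univ : Set P) :=
  ⟨fun _ => isClosed_univ, fun _ _ => MeasurableSet.const _⟩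

lemma IsMeasurableCorrespondence.exists_isMinOn [CompactSpace P] [LinearOrder R]
    [TopologicalSpace R] {C : X → Set P} (hC : IsMeasurableCorrespondence C) {f : P → R}
    (hf : LowerSemicontinuous f) {F : Set P} (hF : IsClosed F) {x : X} (h : (C x ∩ F).Nonempty) :
    ∃ p ∈ C x ∩ F, ∀ q ∈ C x ∩ F, f p ≤ f q :=
  (hf.lowerSemicontinuousOn _).exists_isMinOn h ((hC.isClosed x).inter hF).isCompact

lemma IsMeasurableCorrespondence.nonempty_argmin [CompactSpace P] [LinearOrder R]
    [TopologicalSpace R] {C : X → Set P} (hC : IsMeasurableCorrespondence C) {f : P → R}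
    (hf : LowerSemicontinuous f) {x : X} (h : (C x).Nonempty) :
    (argminCorrespondence f C x).Nonempty := by
  obtain ⟨p, hp, hmin⟩ := hC.exists_isMinOn hf isClosed_univ (by simpa using h)
  exact ⟨p, hp.1, fun q hq => hmin q ⟨hq, trivial⟩⟩

/-- A minimizer over `C x` lies in `F` exactly when the minimum over `C x ∩ F` does not exceed the
one over `C x`. Comparing sublevel sets at a countable dense set of thresholds detects this. -/
lemma IsMeasurableCorrespondence.argmin [CompactSpace P] [LinearOrder R] [TopologicalSpace R]
    [OrderTopology R] [DenselyOrdered R] [SeparableSpace R] {C : X → Set P}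
    (hC : IsMeasurableCorrespondence C) {f : P → R} (hf : LowerSemicontinuous f) :
    IsMeasurableCorrespondence (argminCorrespondence f C) where
  isClosed x := by
    have : argminCorrespondence f C x = C x ∩ ⋂ q ∈ C x, f ⁻¹' Set.Iic (f q) := by
      ext p; simp [argminCorrespondence]
    rw [this]
    exact (hC.isClosed x).inter (isClosed_biInter fun q _ => hf.isClosed_preimage _)
  measurableSet F hF := by
    obtain ⟨D, hDc, hD⟩ := exists_countable_dense R
    have key : {x | (argminCorrespondence f C x ∩ F).Nonempty} =
        {x | (C x ∩ F).Nonempty} ∩ ⋂ t ∈ D, ({x | (C x ∩ f ⁻¹' Set.Iic t).Nonempty}ᶜ ∪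
          {x | (C x ∩ (F ∩ f ⁻¹' Set.Iic t)).Nonempty}) := by
      ext x
      simp only [Set.mem_inter_iff, Set.mem_iInter, Set.mem_union, Set.mem_compl_iff]
      constructor
      · rintro ⟨p, ⟨hp, hmin⟩, hpF⟩
        refine ⟨⟨p, hp, hpF⟩, fun t _ => or_iff_not_imp_left.2 fun h => ?_⟩
        obtain ⟨q, hq, hqt⟩ := not_not.1 h
        exact ⟨p, hp, hpF, (hmin q hq).trans hqt⟩
      · rintro ⟨hne, hall⟩
        obtain ⟨p, ⟨hp, hpF⟩, hmin⟩ := hC.exists_isMinOn hf hF hne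
        refine ⟨p, ⟨hp, fun q hq => ?_⟩, hpF⟩
        by_contra! hlt
        obtain ⟨t, htD, hqt, htp⟩ := hD.exists_between hlt
        rcases hall t htD with h | ⟨r, hr, hrF, hrt⟩
        · exact h ⟨q, hq, hqt.le⟩
        · exact absurd (hmin r ⟨hr, hrF⟩) (not_le.2 (lt_of_le_of_lt hrt htp))
    rw [key]
    exact (hC.measurableSet F hF).inter <| MeasurableSet.biInter hDc fun t _ =>
      (hC.measurableSet _ (hf.isClosed_preimage t)).compl.union
        (hC.measurableSet _ (hF.inter (hf.isClosed_preimage t)))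

/-- The image of `C x ∩ F` under `f` is compact, hence closed, so it contains `a x` as soon as it
meets the closure of every basic open set around `a x`. Closures keep the test sets closed, and
regularity makes them small enough. -/
lemma IsMeasurableCorrespondence.inter_fiber [CompactSpace P] [TopologicalSpace R]
    [T2Space R] [RegularSpace R] [SecondCountableTopology R] [MeasurableSpace R]
    [OpensMeasurableSpace R] {C : X → Set P} (hC : IsMeasurableCorrespondence C) {f : P → R}
    (hf : Continuous f) {a : X → R} (ha : Measurable a) :
    IsMeasurableCorrespondence fun x => C x ∩ {p | f p = a x} where
  isClosed x := (hC.isClosed x).inter (isClosed_eq hf continuous_const)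
  measurableSet F hF := by
    have key : {x | (C x ∩ {p | f p = a x} ∩ F).Nonempty} =
        ⋂ B ∈ countableBasis R,
          ((a ⁻¹' B)ᶜ ∪ {x | (C x ∩ (F ∩ f ⁻¹' closure B)).Nonempty}) := by
      ext x
      simp only [Set.mem_iInter, Set.mem_union, Set.mem_compl_iff]
      constructor
      · rintro ⟨p, ⟨hp, hpa⟩, hpF⟩ B _
        refine or_iff_not_imp_left.2 fun h => ⟨p, hp, hpF, ?_⟩
        rw [Set.mem_preimage, hpa]
        exact subset_closure (not_not.1 h)
      · intro hall
        have hcl : IsClosed (f '' (C x ∩ F)) :=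
          (((hC.isClosed x).inter hF).isCompact.image hf).isClosed
        by_contra hne
        have hax : a x ∈ (f '' (C x ∩ F))ᶜ := by
          rintro ⟨p, ⟨hp, hpF⟩, hpa⟩
          exact hne ⟨p, ⟨hp, hpa⟩, hpF⟩
        obtain ⟨B, hB, haB, hBs⟩ := (isBasis_countableBasis R).exists_closure_subset
          (hcl.isOpen_compl.mem_nhds hax)
        rcases hall B hB with h | ⟨p, hp, hpF, hpB⟩
        · exact h haB
        · exact hBs hpB ⟨p, ⟨hp, hpF⟩, rfl⟩
    rw [key]
    exact MeasurableSet.biInter (countable_countableBasis R) fun B hB =>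
      (ha (isOpen_of_mem_countableBasis hB).measurableSet).compl.union
        (hC.measurableSet _ (hF.inter (isClosed_closure.preimage hf)))

lemma IsMeasurableCorrespondence.iInter_nat [CompactSpace P] {C : ℕ → X → Set P}
    (hC : ∀ n, IsMeasurableCorrespondence (C n)) (hmono : ∀ n x, C (n + 1) x ⊆ C n x) :
    IsMeasurableCorrespondence fun x => ⋂ n, C n x where
  isClosed x := isClosed_iInter fun n => (hC n).isClosed x
  measurableSet F hF := by
    have key : {x | ((⋂ n, C n x) ∩ F).Nonempty} = ⋂ n, {x | (C n x ∩ F).Nonempty} := by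
      ext x
      simp only [Set.mem_iInter]
      constructor
      · rintro ⟨p, hp, hpF⟩ n
        exact ⟨p, Set.mem_iInter.1 hp n, hpF⟩
      · intro h
        have := IsCompact.nonempty_iInter_of_sequence_nonempty_isCompact_isClosed
          (fun n => C n x ∩ F) (fun n => Set.inter_subset_inter_left _ (hmono n x)) h
          (((hC 0).isClosed x).inter hF).isCompact (fun n => ((hC n).isClosed x).inter hF)
        rwa [← Set.iInter_inter] at this
    rw [key]
    exact MeasurableSet.iInter fun n => (hC n).measurableSet F hF

lemma nonempty_iInter_nat [CompactSpace P] {C : ℕ → X → Set P}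
    (hC : ∀ n, IsMeasurableCorrespondence (C n)) (hmono : ∀ n x, C (n + 1) x ⊆ C n x) {x : X}
    (h : ∀ n, (C n x).Nonempty) : (⋂ n, C n x).Nonempty :=
  IsCompact.nonempty_iInter_of_sequence_nonempty_isCompact_isClosed _ (fun n => hmono n x) h
    ((hC 0).isClosed x).isCompact fun n => (hC n).isClosed x

/-- Cutting a measurable correspondence by countably many equations `f n p = a n x`. -/
lemma IsMeasurableCorrespondence.inter_fibers [CompactSpace P] [TopologicalSpace R]
    [T2Space R] [RegularSpace R] [SecondCountableTopology R] [MeasurableSpace R]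
    [OpensMeasurableSpace R] {C : X → Set P} (hC : IsMeasurableCorrespondence C) {f : ℕ → P → R}
    (hf : ∀ n, Continuous (f n)) {a : ℕ → X → R} (ha : ∀ n, Measurable (a n)) :
    IsMeasurableCorrespondence fun x => C x ∩ {p | ∀ n, f n p = a n x} := by
  let D : ℕ → X → Set P := fun n x => C x ∩ {p | ∀ k < n, f k p = a k x}
  have hD : ∀ n, IsMeasurableCorrespondence (D n) := by
    intro n
    induction n with
    | zero => simpa [D] using hC
    | succ n ih =>
      convert ih.inter_fiber (hf n) (ha n) using 2 with x
      ext p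
      simp only [D, Set.mem_inter_iff, Set.mem_ofPred_eq, Nat.lt_succ_iff_lt_or_eq, or_imp,
        forall_and, forall_eq, and_assoc]
  convert IsMeasurableCorrespondence.iInter_nat hD
    (fun n x p hp => ⟨hp.1, fun k hk => hp.2 k (hk.trans n.lt_succ_self)⟩) using 2 with x
  ext p
  simp only [D, Set.mem_inter_iff, Set.mem_ofPred_eq, Set.mem_iInter]
  exact ⟨fun h n => ⟨h.1, fun k _ => h.2 k⟩,
    fun h => ⟨(h 0).1, fun n => (h (n + 1)).2 n n.lt_succ_self⟩⟩

/-- A measurable correspondence with nonempty values in a compact space whose points are separated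
by countably many continuous functions has a measurable selection. -/
theorem IsMeasurableCorrespondence.exists_selection [CompactSpace P] [LinearOrder R]
    [TopologicalSpace R] [OrderTopology R] [DenselyOrdered R] [SeparableSpace R] {C : X → Set P}
    (hC : IsMeasurableCorrespondence C) (hne : ∀ x, (C x).Nonempty) {f : ℕ → P → R}
    (hf : ∀ n, Continuous (f n)) (hsep : ∀ p q, (∀ n, f n p = f n q) → p = q) :
    ∃ s : X → P, (∀ x, s x ∈ C x) ∧ ∀ F, IsClosed F → MeasurableSet (s ⁻¹' F) := by
  -- Lexicographic minimization: two points surviving every stage share all values `f n`, so they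
  -- coincide.
  let D : ℕ → X → Set P := fun n => n.rec C fun n C' => argminCorrespondence (f n) C'
  have hD : ∀ n, IsMeasurableCorrespondence (D n) := by
    intro n
    induction n with
    | zero => exact hC
    | succ n ih => exact ih.argmin (hf n).lowerSemicontinuous
  have hDne : ∀ n x, (D n x).Nonempty := by
    intro n x
    induction n with
    | zero => exact hne x
    | succ n ih => exact (hD n).nonempty_argmin (hf n).lowerSemicontinuous ih
  have hmono : ∀ n x, D (n + 1) x ⊆ D n x := fun n x p hp => hp.1
  choose s hs using fun x => nonempty_iInter_nat hD hmono (fun n => hDne n x)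
  have huniq : ∀ x, ∀ p ∈ ⋂ n, D n x, p = s x := by
    intro x p hp
    have h1 := fun n => Set.mem_iInter.1 hp n
    have h2 := fun n => Set.mem_iInter.1 (hs x) n
    exact hsep _ _ fun n => le_antisymm ((h1 (n + 1)).2 _ (h2 n)) ((h2 (n + 1)).2 _ (h1 n))
  refine ⟨s, fun x => Set.mem_iInter.1 (hs x) 0, fun F hF => ?_⟩
  convert (IsMeasurableCorrespondence.iInter_nat hD hmono).measurableSet F hF using 1
  ext x
  exact ⟨fun h => ⟨s x, hs x, h⟩, fun ⟨p, hp, hpF⟩ => by rwa [huniq x p hp] at hpF⟩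

end Selection

/-! ### Testing measures against continuous functions -/

section Kernels

variable {X : Type*} [MeasurableSpace X]

/-- On a compact metrizable space, countably many continuous functions determine a finite measure. -/
lemma exists_seq_continuousMap_determining (W : Type*) [MetricSpace W] [CompactSpace W]
    [MeasurableSpace W] [BorelSpace W] :
    ∃ f : ℕ → C(W, ℝ≥0), ∀ μ ν : Measure W, IsFiniteMeasure μ → IsFiniteMeasure ν →
      (∀ n, ∫⁻ x, f n x ∂μ = ∫⁻ x, f n x ∂ν) → μ = ν := by
  refine ⟨denseSeq C(W, ℝ≥0), fun μ ν hμ hν h => ?_⟩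
  -- Integration against a finite measure is continuous in the test function, so a dense sequence of
  -- test functions suffices.
  let T : FiniteMeasure W → C(W, ℝ≥0) → ℝ≥0 := fun ρ f =>
    ρ.testAgainstNN (BoundedContinuousFunction.mkOfCompact f)
  have hT : ∀ ρ, Continuous (T ρ) := fun ρ =>
    (FiniteMeasure.testAgainstNN_lipschitz ρ).continuous.comp
      (ContinuousMap.isometryEquivBoundedOfCompact W ℝ≥0).continuous
  have hEq : T ⟨μ, hμ⟩ = T ⟨ν, hν⟩ :=
    (denseRange_denseSeq C(W, ℝ≥0)).equalizer (hT _) (hT _) <| funext fun n =>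
      congrArg ENNReal.toNNReal (h n)
  refine ext_of_forall_lintegral_eq_of_IsFiniteMeasure fun f => ?_
  have hcoe : ∀ ρ : FiniteMeasure W, ((T ρ f.toContinuousMap : ℝ≥0) : ℝ≥0∞) = ∫⁻ x, f x ∂ρ :=
    fun ρ => FiniteMeasure.testAgainstNN_coe_eq
  exact (hcoe ⟨μ, hμ⟩).symm.trans ((congrArg _ (congrFun hEq _)).trans (hcoe ⟨ν, hν⟩))

/-- Closed sets form a generating π-system, and the indicator of a closed set is a limit of bounded
continuous functions, whose integrals are weakly continuous in the measure. -/
lemma measurable_toMeasure_of_isClosed {W : Type*} [TopologicalSpace W] [HasOuterApproxClosed W]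
    [MeasurableSpace W] [BorelSpace W] {s : X → ProbabilityMeasure W}
    (hs : ∀ F, IsClosed F → MeasurableSet (s ⁻¹' F)) :
    Measurable fun x => (s x : Measure W) := by
  have hgen := BorelSpace.measurable_eq (α := W)
  rw [borel_eq_generateFrom_isClosed] at hgen
  refine Measurable.measure_of_isPiSystem_of_isProbabilityMeasure hgen
    isPiSystem_isClosed fun A hA => ?_
  refine measurable_of_tendsto_metrizable (f := fun n x => ∫⁻ w, hA.apprSeq n w ∂(s x)) ?_ ?_
  · refine fun n => measurable_of_isClosed fun F hF => ?_
    exact hs _ (hF.preimage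
      (ProbabilityMeasure.continuous_lintegral_boundedContinuousFunction (hA.apprSeq n)))
  · exact tendsto_pi_nhds.2 fun x => HasOuterApproxClosed.tendsto_lintegral_apprSeq hA _

end Kernels

/-! ### Optimal couplings depending measurably on a parameter -/

section OptimalCoupling

variable {X : Type*} [MeasurableSpace X]

lemma IsCoupling.isProbabilityMeasure {Y Z : Type*} [MeasurableSpace Y] [MeasurableSpace Z]
    {γ : Measure (Y × Z)} {μ : Measure Y} {ν : Measure Z} [IsProbabilityMeasure μ]
    (h : IsCoupling γ μ ν) : IsProbabilityMeasure γ := by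
  have : IsProbabilityMeasure (γ.map Prod.fst) := by rw [h.1]; infer_instance
  exact Measure.isProbabilityMeasure_of_map Prod.fst

lemma isCoupling_prod {Y Z : Type*} [MeasurableSpace Y] [MeasurableSpace Z] (μ : Measure Y)
    (ν : Measure Z) [IsProbabilityMeasure μ] [IsProbabilityMeasure ν] :
    IsCoupling (μ.prod ν) μ ν := by
  simp [IsCoupling, Measure.map_fst_prod, Measure.map_snd_prod]

/-- Measurable selection of optimal couplings on a compact metric space, for a cost that is the
supremum of an increasing sequence of continuous functions. -/
theorem exists_kernel_optimal_of_compactSpace {K : Type*} [MetricSpace K] [CompactSpace K]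
    [MeasurableSpace K] [BorelSpace K] (c : ℕ → C(K × K, ℝ≥0)) (hc : Monotone c)
    (μ ν : Kernel X K) [IsMarkovKernel μ] [IsMarkovKernel ν] :
    ∃ κ : Kernel X (K × K), IsMarkovKernel κ ∧ ∀ x, IsCoupling (κ x) (μ x) (ν x) ∧
      ∀ γ : Measure (K × K), IsCoupling γ (μ x) (ν x) →
        ∫⁻ p, ⨆ n, (c n p : ℝ≥0∞) ∂(κ x) ≤ ∫⁻ p, ⨆ n, (c n p : ℝ≥0∞) ∂γ := by
  obtain ⟨f, hf⟩ := exists_seq_continuousMap_determining K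
  obtain ⟨g, hg⟩ := exists_seq_continuousMap_determining (K × K)
  have hcont : ∀ h : C(K × K, ℝ≥0),
      Continuous fun γ : ProbabilityMeasure (K × K) => ∫⁻ p, h p ∂(γ : Measure (K × K)) :=
    fun h => ProbabilityMeasure.continuous_lintegral_continuousMap h
  let cost : ProbabilityMeasure (K × K) → ℝ≥0∞ := fun γ =>
    ∫⁻ p, ⨆ n, (c n p : ℝ≥0∞) ∂(γ : Measure (K × K))
  have hcost : LowerSemicontinuous cost := by
    have : cost = fun γ : ProbabilityMeasure (K × K) => ⨆ n, ∫⁻ p, (c n p : ℝ≥0∞) ∂(γ : Measure (K × K)) := by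
      funext γ
      refine lintegral_iSup (fun n => by fun_prop) fun m n hmn p => ?_
      exact ENNReal.coe_le_coe.2 (hc hmn p)
    rw [this]
    exact lowerSemicontinuous_iSup fun n => (hcont (c n)).lowerSemicontinuous
  let C : X → Set (ProbabilityMeasure (K × K)) := fun x =>
    {γ | IsCoupling (γ : Measure (K × K)) (μ x) (ν x)}
  -- Each marginal constraint amounts to countably many equations between integrals of continuous
  -- functions.
  have hC : IsMeasurableCorrespondence C := by
    have h1 := (isMeasurableCorrespondence_univ (X := X)).inter_fibers
      (fun n => hcont ((f n).comp ⟨Prod.fst, continuous_fst⟩))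
      (fun n => Measurable.lintegral_kernel (κ := μ)
        (f n).continuous.measurable.coe_nnreal_ennreal)
    have h2 := h1.inter_fibers
      (fun n => hcont ((f n).comp ⟨Prod.snd, continuous_snd⟩))
      (fun n => Measurable.lintegral_kernel (κ := ν)
        (f n).continuous.measurable.coe_nnreal_ennreal)
    convert h2 using 2 with x
    ext γ
    have e1 : ∀ n, ∫⁻ y, f n y ∂((γ : Measure (K × K)).map Prod.fst)
        = ∫⁻ p, f n p.1 ∂(γ : Measure (K × K)) := fun n =>
      lintegral_map (f n).continuous.measurable.coe_nnreal_ennreal measurable_fst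
    have e2 : ∀ n, ∫⁻ y, f n y ∂((γ : Measure (K × K)).map Prod.snd)
        = ∫⁻ p, f n p.2 ∂(γ : Measure (K × K)) := fun n =>
      lintegral_map (f n).continuous.measurable.coe_nnreal_ennreal measurable_snd
    simp only [C, IsCoupling, Set.mem_inter_iff, Set.mem_univ, true_and, Set.mem_ofPred_eq,
      ContinuousMap.comp_apply, ContinuousMap.coe_mk]
    refine and_congr ⟨fun h n => ?_, fun h => ?_⟩ ⟨fun h n => ?_, fun h => ?_⟩
    · rw [← e1, h]
    · exact hf _ _ inferInstance inferInstance fun n => by rw [e1, h]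
    · rw [← e2, h]
    · exact hf _ _ inferInstance inferInstance fun n => by rw [e2, h]
  have hCne : ∀ x, (C x).Nonempty := fun x =>
    ⟨⟨(μ x).prod (ν x), inferInstance⟩, isCoupling_prod (μ x) (ν x)⟩
  obtain ⟨s, hsC, hsm⟩ := (hC.argmin hcost).exists_selection
    (fun x => hC.nonempty_argmin hcost (hCne x)) (fun n => hcont (g n))
    (fun γ γ' h => Subtype.ext (hg _ _ γ.toFiniteMeasure.2 γ'.toFiniteMeasure.2 h))
  refine ⟨⟨fun x => s x, measurable_toMeasure_of_isClosed hsm⟩, ⟨fun x => (s x).2⟩,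
    fun x => ⟨(hsC x).1, fun γ hγ => ?_⟩⟩
  exact (hsC x).2 ⟨γ, hγ.isProbabilityMeasure⟩ hγ

/-- Measurable selection of optimal couplings for the quadratic cost. -/
theorem exists_kernel_isOptimalCoupling {Z : Type*} [NormedAddCommGroup Z] [NormedSpace ℝ Z]
    [FiniteDimensional ℝ Z] [MeasurableSpace Z] [BorelSpace Z]
    (μ ν : Kernel X Z) [IsMarkovKernel μ] [IsMarkovKernel ν] :
    ∃ κ : Kernel X (Z × Z), IsMarkovKernel κ ∧ ∀ x, IsOptimalCoupling (κ x) (μ x) (ν x) := by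
  have : ProperSpace Z := FiniteDimensional.proper ℝ Z
  let K := Metric.closedBall (0 : Z × ℝ) 1
  have : CompactSpace K := isCompact_iff_compactSpace.1 (isCompact_closedBall _ _)
  -- Homogeneous coordinates: `z` goes to `(z, 1) / (1 + ‖z‖)`, and points at infinity have last
  -- coordinate `0`.
  let r : Z → ℝ := fun z => (1 + ‖z‖)⁻¹
  have hr0 : ∀ z, 0 < r z := fun z => by positivity
  have hrc : Continuous r := by
    refine Continuous.inv₀ (by fun_prop) fun z => by positivity
  have hmem : ∀ z, (r z • z, r z) ∈ K := by
    intro z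
    have h1 : r z ≤ 1 := inv_le_one_of_one_le₀ (by linarith [norm_nonneg z])
    have h2 : ‖r z • z‖ ≤ 1 := by
      rw [norm_smul, Real.norm_of_nonneg (hr0 z).le, inv_mul_le_iff₀ (by positivity)]
      linarith
    simpa [K, Prod.norm_def, abs_of_pos (hr0 z)] using ⟨h2, h1⟩
  let i : Z → K := fun z => ⟨(r z • z, r z), hmem z⟩
  have hi : Measurable i := by
    refine Continuous.measurable (Continuous.subtype_mk ?_ _)
    fun_prop
  -- At infinity this takes the junk value `0`; the measures `ρ.map i` give no mass there.
  let j : K → Z := fun u => (u.1.2)⁻¹ • u.1.1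
  have hj : Measurable j := by fun_prop
  have hji : ∀ z, j (i z) = z := fun z => inv_smul_smul₀ (hr0 z).ne' z
  let N : C(K × K, ℝ≥0) := ⟨fun p => ‖p.2.1.2 • p.1.1.1 - p.1.1.2 • p.2.1.1‖₊ ^ 2, by fun_prop⟩
  let D : C(K × K, ℝ≥0) := ⟨fun p => ‖p.1.1.2 * p.2.1.2‖₊ ^ 2, by fun_prop⟩
  -- The quadratic cost is `N / D` in these coordinates. Adding `1 / (n + 1)` to `D` makes the
  -- quotient continuous at infinity too, and it increases to `N / D` where `D` is nonzero.
  let c : ℕ → C(K × K, ℝ≥0) := fun n =>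
    ⟨fun p => N p / (D p + ((n : ℝ≥0) + 1)⁻¹), by
      refine N.continuous.div₀ (by fun_prop) fun p => by positivity⟩
  have hc : Monotone c := by
    intro m n hmn p
    change N p / (D p + ((m : ℝ≥0) + 1)⁻¹) ≤ N p / (D p + ((n : ℝ≥0) + 1)⁻¹)
    gcongr
  have hceq : ∀ p : K × K, p.1.1.2 ≠ 0 → p.2.1.2 ≠ 0 →
      ⨆ n, (c n p : ℝ≥0∞) = ‖j p.1 - j p.2‖ₑ ^ 2 := by
    intro p h1 h2
    have hD : D p ≠ 0 := by simp [D, h1, h2]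
    have hlim : Tendsto (fun n => c n p) atTop (𝓝 (N p / D p)) := by
      have h0 : Tendsto (fun n : ℕ => D p + ((n : ℝ≥0) + 1)⁻¹) atTop (𝓝 (D p + 0)) := by
        refine tendsto_const_nhds.add ?_
        have := tendsto_one_div_add_atTop_nhds_zero_nat (𝕜 := ℝ≥0)
        simpa using this
      rw [add_zero] at h0
      exact tendsto_const_nhds.div h0 hD
    have hsup : ⨆ n, (c n p : ℝ≥0∞) = ((N p / D p : ℝ≥0) : ℝ≥0∞) :=
      tendsto_nhds_unique
        (tendsto_atTop_iSup fun m n hmn => ENNReal.coe_le_coe.2 (hc hmn p))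
        (ENNReal.tendsto_coe.2 hlim)
    have hfac : p.2.1.2 • p.1.1.1 - p.1.1.2 • p.2.1.1 =
        (p.1.1.2 * p.2.1.2) • (j p.1 - j p.2) := by
      simp only [j, smul_sub, smul_smul]
      congr 2 <;> field_simp
    have hN : N p = D p * ‖j p.1 - j p.2‖₊ ^ 2 := by
      change ‖p.2.1.2 • p.1.1.1 - p.1.1.2 • p.2.1.1‖₊ ^ 2 = ‖p.1.1.2 * p.2.1.2‖₊ ^ 2 * _
      rw [hfac, nnnorm_smul, mul_pow]
    rw [hsup, hN, mul_div_cancel_left₀ _ hD]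
    simp [enorm_eq_nnnorm]
  have hμi := Kernel.IsMarkovKernel.map μ hi
  have hνi := Kernel.IsMarkovKernel.map ν hi
  obtain ⟨κ, hκ, hopt⟩ := exists_kernel_optimal_of_compactSpace c hc (μ.map i) (ν.map i)
  have hjj : Measurable (Prod.map j j) := hj.prodMap hj
  have hii : Measurable (Prod.map i i) := hi.prodMap hi
  have hjimap : ∀ ρ : Measure Z, (ρ.map i).map j = ρ := fun ρ => by
    rw [Measure.map_map hj hi, show j ∘ i = id from funext hji, Measure.map_id]
  have hpos : ∀ ρ : Measure Z, ∀ᵐ u ∂(ρ.map i), u.1.2 ≠ 0 := fun ρ =>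
    (ae_map_iff hi.aemeasurable (measurableSet_eq_fun (by fun_prop) (by fun_prop)).compl).2 <|
      Eventually.of_forall fun z => (hr0 z).ne'
  have hZm : Measurable fun p : Z × Z => ‖p.1 - p.2‖ₑ ^ 2 := by fun_prop
  refine ⟨κ.map (Prod.map j j), Kernel.IsMarkovKernel.map κ hjj, fun x => ?_⟩
  obtain ⟨⟨hfst, hsnd⟩, hmin⟩ := hopt x
  simp only [Kernel.map_apply _ hi] at hfst hsnd hmin
  rw [Kernel.map_apply _ hjj]
  refine ⟨⟨?_, ?_⟩, fun γ hγ => ?_⟩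
  · rw [Measure.map_map measurable_fst hjj, show Prod.fst ∘ Prod.map j j = j ∘ Prod.fst from rfl,
      ← Measure.map_map hj measurable_fst, hfst, hjimap]
  · rw [Measure.map_map measurable_snd hjj, show Prod.snd ∘ Prod.map j j = j ∘ Prod.snd from rfl,
      ← Measure.map_map hj measurable_snd, hsnd, hjimap]
  · have hcost : transportCost ((κ x).map (Prod.map j j)) = ∫⁻ p, ⨆ n, (c n p : ℝ≥0∞) ∂(κ x) := by
      rw [transportCost, lintegral_map hZm hjj]
      refine lintegral_congr_ae ?_
      have h1 := ae_of_ae_map measurable_fst.aemeasurable (hfst ▸ hpos (μ x))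
      have h2 := ae_of_ae_map measurable_snd.aemeasurable (hsnd ▸ hpos (ν x))
      filter_upwards [h1, h2] with p hp1 hp2
      exact (hceq p hp1 hp2).symm
    have hcm : Measurable fun p => ⨆ n, (c n p : ℝ≥0∞) :=
      Measurable.iSup fun n => (c n).continuous.measurable.coe_nnreal_ennreal
    rw [hcost]
    refine (hmin (γ.map (Prod.map i i)) ⟨?_, ?_⟩).trans_eq ?_
    · rw [Measure.map_map measurable_fst hii, show Prod.fst ∘ Prod.map i i = i ∘ Prod.fst from rfl,
        ← Measure.map_map hi measurable_fst, hγ.1]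
    · rw [Measure.map_map measurable_snd hii, show Prod.snd ∘ Prod.map i i = i ∘ Prod.snd from rfl,
        ← Measure.map_map hi measurable_snd, hγ.2]
    · rw [transportCost, lintegral_map hcm hii]
      refine lintegral_congr fun p => ?_
      rw [hceq _ (hr0 p.1).ne' (hr0 p.2).ne']
      simp [hji]

end OptimalCoupling

/-! ### Measures under essentially injective maps -/

section Disintegration

/-- A measurable map which is injective on a conull set separates the measures carried by it. -/
lemma eq_of_map_eq_of_injOn {Y Z : Type*} [MeasurableSpace Y] [StandardBorelSpace Y]
    [MeasurableSpace Z] [StandardBorelSpace Z] {f : Y → Z} (hf : Measurable f) {A : Set Y}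
    (hA : MeasurableSet A) (hinj : Set.InjOn f A) {ρ σ : Measure Y} (hρ : ∀ᵐ y ∂ρ, y ∈ A)
    (hσ : ∀ᵐ y ∂σ, y ∈ A) (h : ρ.map f = σ.map f) : ρ = σ := by
  have key : ∀ τ : Measure Y, (∀ᵐ y ∂τ, y ∈ A) → ∀ B, MeasurableSet B →
      τ B = τ.map f (f '' (B ∩ A)) := by
    intro τ hτ B hB
    -- Lusin–Souslin: injective Borel images of Borel sets are Borel.
    have him : MeasurableSet (f '' (B ∩ A)) :=
      (hB.inter hA).image_of_measurable_injOn hf (hinj.mono Set.inter_subset_right)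
    rw [Measure.map_apply hf him]
    refine measure_congr ?_
    filter_upwards [hτ] with y hy
    refine propext ⟨fun hyB => ⟨y, ⟨hyB, hy⟩, rfl⟩, ?_⟩
    rintro ⟨z, ⟨hzB, hzA⟩, hz⟩
    exact hinj hzA hy hz ▸ hzB
  ext B hB
  rw [key ρ hρ B hB, key σ hσ B hB, h]

lemma map_compProd_comap {Y Z W : Type*} [MeasurableSpace Y] [MeasurableSpace Z]
    [MeasurableSpace W] (μ : Measure Y) [IsFiniteMeasure μ] {f : Y → Z} (hf : Measurable f)
    (κ : Kernel Z W) [IsMarkovKernel κ] :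
    (μ ⊗ₘ κ.comap f hf).map (Prod.map f id) = (μ.map f) ⊗ₘ κ := by
  refine Measure.ext_of_lintegral _ fun g hg => ?_
  rw [lintegral_map hg (hf.prodMap measurable_id), Measure.lintegral_compProd (by fun_prop),
    Measure.lintegral_compProd hg, lintegral_map (by fun_prop) hf]
  rfl

end Disintegration

/-! ### Subspace-optimal plans and their fibers -/

section Plans

variable {d : ℕ} {E : Submodule ℝ (EuclideanSpace ℝ (Fin d))}

lemma measurable_orthogonalProjectionOnto (F : Submodule ℝ (EuclideanSpace ℝ (Fin d))) :
    Measurable fun x => F.orthogonalProjectionOnto x :=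
  F.orthogonalProjectionOnto.continuous.measurable

lemma orthogonalProjectionOnto_add_coe (x : E) (a : Eᗮ) :
    E.orthogonalProjectionOnto ((x : EuclideanSpace ℝ (Fin d)) + a) = x ∧
      Eᗮ.orthogonalProjectionOnto ((x : EuclideanSpace ℝ (Fin d)) + a) = a := by
  constructor <;> simp

lemma coe_add_orthogonalProjectionOnto (x : EuclideanSpace ℝ (Fin d)) :
    (E.orthogonalProjectionOnto x : EuclideanSpace ℝ (Fin d)) + Eᗮ.orthogonalProjectionOnto x = x := by
  simp

lemma enorm_sq_eq_add_orthogonalProjectionOnto (x : EuclideanSpace ℝ (Fin d)) :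
    ‖x‖ₑ ^ 2 = ‖E.orthogonalProjectionOnto x‖ₑ ^ 2 + ‖Eᗮ.orthogonalProjectionOnto x‖ₑ ^ 2 := by
  have h := E.norm_sq_eq_add_norm_sq_projection x
  have h' : ‖x‖₊ ^ 2 = ‖E.orthogonalProjectionOnto x‖₊ ^ 2 +
      ‖Eᗮ.orthogonalProjectionOnto x‖₊ ^ 2 := NNReal.coe_injective (by push_cast; exact h)
  simp only [enorm_eq_nnnorm]
  exact_mod_cast h'

lemma isProbabilityMeasure_projMeasure (μ : Measure (EuclideanSpace ℝ (Fin d)))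
    [IsProbabilityMeasure μ] : IsProbabilityMeasure (projMeasure E μ) :=
  Measure.isProbabilityMeasure_map (measurable_orthogonalProjectionOnto E).aemeasurable

lemma transportCost_lt_top {μ ν : Measure (EuclideanSpace ℝ (Fin d))}
    (hμ : MemLp (fun x => x) 2 μ) (hν : MemLp (fun x => x) 2 ν)
    {γ : Measure (EuclideanSpace ℝ (Fin d) × EuclideanSpace ℝ (Fin d))}
    (hγ : IsCoupling γ μ ν) : transportCost γ < ∞ := by
  have h1 : MemLp (fun p : EuclideanSpace ℝ (Fin d) × EuclideanSpace ℝ (Fin d) => p.1) 2 γ :=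
    hμ.comp_measurePreserving ⟨measurable_fst, hγ.1⟩
  have h2 : MemLp (fun p : EuclideanSpace ℝ (Fin d) × EuclideanSpace ℝ (Fin d) => p.2) 2 γ :=
    hν.comp_measurePreserving ⟨measurable_snd, hγ.2⟩
  have := lintegral_rpow_enorm_lt_top_of_eLpNorm_lt_top two_ne_zero ENNReal.ofNat_ne_top
    (h1.sub h2).2
  simpa [transportCost] using this

variable {μ ν : Measure (EuclideanSpace ℝ (Fin d))} {S : E → E} {κμ κν : Kernel E Eᗮ}

/-- The projections of both coordinates of a plan on `Eᗮ`, with the projection of the first one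
on `E`. -/
noncomputable def fiberProj (E : Submodule ℝ (EuclideanSpace ℝ (Fin d)))
    (p : EuclideanSpace ℝ (Fin d) × EuclideanSpace ℝ (Fin d)) : E × (Eᗮ × Eᗮ) :=
  (E.orthogonalProjectionOnto p.1,
    (Eᗮ.orthogonalProjectionOnto p.1, Eᗮ.orthogonalProjectionOnto p.2))

lemma measurable_fiberProj : Measurable (fiberProj E) := by
  have h1 := measurable_orthogonalProjectionOnto E
  have h2 := measurable_orthogonalProjectionOnto Eᗮ
  exact (h1.comp measurable_fst).prodMk
    ((h2.comp measurable_fst).prodMk (h2.comp measurable_snd))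

lemma measurable_projPlan_map : Measurable fun p : EuclideanSpace ℝ (Fin d) ×
    EuclideanSpace ℝ (Fin d) => (E.orthogonalProjectionOnto p.1, E.orthogonalProjectionOnto p.2) := by
  have h1 := measurable_orthogonalProjectionOnto E
  exact (h1.comp measurable_fst).prodMk (h1.comp measurable_snd)

lemma IsDisintegration.map_add (hκμ : IsDisintegration E μ κμ) :
    (projMeasure E μ ⊗ₘ κμ).map (fun p => (p.1 : EuclideanSpace ℝ (Fin d)) + p.2) = μ := by
  rw [← hκμ.eq_compProd, Measure.map_map (by fun_prop)
    ((measurable_orthogonalProjectionOnto E).prodMk (measurable_orthogonalProjectionOnto Eᗮ))]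
  convert Measure.map_id
  funext x
  exact coe_add_orthogonalProjectionOnto x

/-- Pythagoras for `E ⊕ Eᗮ`. The first term is the same for all subspace-optimal plans, so only the
fiber costs compete. -/
lemma transportCost_eq_of_fiberProj [IsProbabilityMeasure μ] (hS : Measurable S)
    {γ : Measure (EuclideanSpace ℝ (Fin d) × EuclideanSpace ℝ (Fin d))}
    (hγ : projPlan E γ = (projMeasure E μ).map fun x => (x, S x)) {η : Kernel E (Eᗮ × Eᗮ)}
    [IsMarkovKernel η] (hη : γ.map (fiberProj E) = projMeasure E μ ⊗ₘ η) :
    transportCost γ = ∫⁻ x, ‖x - S x‖ₑ ^ 2 ∂(projMeasure E μ) +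
      ∫⁻ x, transportCost (η x) ∂(projMeasure E μ) := by
  have := isProbabilityMeasure_projMeasure (E := E) μ
  have h1 : ∫⁻ p, ‖p.1 - p.2‖ₑ ^ 2 ∂(projPlan E γ) =
      ∫⁻ x, ‖x - S x‖ₑ ^ 2 ∂(projMeasure E μ) := by
    rw [hγ, lintegral_map (by fun_prop) (by fun_prop)]
  have h2 : ∫⁻ q, ‖q.2.1 - q.2.2‖ₑ ^ 2 ∂(γ.map (fiberProj E)) =
      ∫⁻ x, transportCost (η x) ∂(projMeasure E μ) := by
    rw [hη, Measure.lintegral_compProd (by fun_prop)]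
    rfl
  rw [← h1, ← h2, projPlan, lintegral_map (by fun_prop) measurable_projPlan_map,
    lintegral_map (by fun_prop) measurable_fiberProj, transportCost,
    ← lintegral_add_left (by
      have := measurable_orthogonalProjectionOnto E
      fun_prop)]
  refine lintegral_congr fun p => ?_
  rw [enorm_sq_eq_add_orthogonalProjectionOnto (E := E) (p.1 - p.2), map_sub, map_sub]
  rfl

lemma measurable_liftPlan_map (hS : Measurable S) : Measurable fun p : E × (Eᗮ × Eᗮ) =>
    ((p.1 : EuclideanSpace ℝ (Fin d)) + (p.2.1 : EuclideanSpace ℝ (Fin d)),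
      (S p.1 : EuclideanSpace ℝ (Fin d)) + (p.2.2 : EuclideanSpace ℝ (Fin d))) := by
  fun_prop

lemma map_fiberProj_liftPlan (hS : Measurable S) (κ : Kernel E (Eᗮ × Eᗮ)) :
    (liftPlan E S μ κ).map (fiberProj E) = projMeasure E μ ⊗ₘ κ := by
  rw [liftPlan, Measure.map_map measurable_fiberProj (measurable_liftPlan_map hS)]
  convert Measure.map_id
  funext p
  exact Prod.ext (orthogonalProjectionOnto_add_coe _ _).1
    (Prod.ext (orthogonalProjectionOnto_add_coe _ _).2 (orthogonalProjectionOnto_add_coe _ _).2)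

lemma projPlan_liftPlan [IsProbabilityMeasure μ] (hS : Measurable S) (κ : Kernel E (Eᗮ × Eᗮ)) [IsMarkovKernel κ] :
    projPlan E (liftPlan E S μ κ) = (projMeasure E μ).map fun x => (x, S x) := by
  have := isProbabilityMeasure_projMeasure (E := E) μ
  rw [projPlan, liftPlan, Measure.map_map measurable_projPlan_map (measurable_liftPlan_map hS)]
  nth_rewrite 2 [← Measure.fst_compProd (projMeasure E μ) κ]
  rw [Measure.fst, Measure.map_map (by fun_prop) measurable_fst]
  congr 1
  funext p
  simp

lemma isCoupling_liftPlan [IsProbabilityMeasure μ]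
    (hS : IsTransportMap S (projMeasure E μ) (projMeasure E ν))
    (hκμ : IsDisintegration E μ κμ) (hκν : IsDisintegration E ν κν) (κ : Kernel E (Eᗮ × Eᗮ))
    [IsMarkovKernel κ]
    (hκ : ∀ᵐ x ∂(projMeasure E μ), IsCoupling (κ x) (κμ x) (κν (S x))) :
    IsCoupling (liftPlan E S μ κ) μ ν := by
  have := isProbabilityMeasure_projMeasure (E := E) μ
  have := hκμ.markov
  have := hκν.markov
  have h1 : (projMeasure E μ ⊗ₘ κ).map (Prod.map id Prod.fst) = projMeasure E μ ⊗ₘ κμ := by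
    rw [← Measure.compProd_map measurable_fst]
    refine Measure.compProd_congr ?_
    filter_upwards [hκ] with x hx
    rw [Kernel.map_apply _ measurable_fst, hx.1]
  have h2 : (projMeasure E μ ⊗ₘ κ).map (Prod.map id Prod.snd) =
      projMeasure E μ ⊗ₘ κν.comap S hS.1 := by
    rw [← Measure.compProd_map measurable_snd]
    refine Measure.compProd_congr ?_
    filter_upwards [hκ] with x hx
    rw [Kernel.map_apply _ measurable_snd, hx.2, Kernel.comap_apply]
  constructor
  · rw [liftPlan, Measure.map_map measurable_fst (measurable_liftPlan_map hS.1)]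
    conv_rhs => rw [← hκμ.map_add, ← h1, Measure.map_map (by fun_prop) (by fun_prop)]
    rfl
  · rw [liftPlan, Measure.map_map measurable_snd (measurable_liftPlan_map hS.1)]
    conv_rhs => rw [← hκν.map_add, ← hS.2, ← map_compProd_comap _ hS.1, ← h2,
      Measure.map_map (hS.1.prodMap measurable_id) (by fun_prop),
      Measure.map_map (by fun_prop) ((hS.1.prodMap measurable_id).comp (by fun_prop))]
    rfl

/-- A subspace-optimal plan disintegrates over `E` into couplings of the conditionals. -/
lemma exists_kernel_of_mem_subspaceOptimalPlans [IsProbabilityMeasure μ] [IsProbabilityMeasure ν]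
    (hS : IsTransportMap S (projMeasure E μ) (projMeasure E ν))
    (hS_inj : ∃ A ∈ ae (projMeasure E μ), Set.InjOn S A)
    (hκμ : IsDisintegration E μ κμ) (hκν : IsDisintegration E ν κν)
    {γ : Measure (EuclideanSpace ℝ (Fin d) × EuclideanSpace ℝ (Fin d))}
    (hγ : γ ∈ subspaceOptimalPlans E S μ ν) :
    ∃ η : Kernel E (Eᗮ × Eᗮ), IsMarkovKernel η ∧ γ.map (fiberProj E) = projMeasure E μ ⊗ₘ η ∧
      ∀ᵐ x ∂(projMeasure E μ), IsCoupling (η x) (κμ x) (κν (S x)) := by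
  have := isProbabilityMeasure_projMeasure (E := E) μ
  have := hκμ.markov
  have := hκν.markov
  have := hγ.1.isProbabilityMeasure
  have hP := measurable_orthogonalProjectionOnto E
  have hQ := measurable_orthogonalProjectionOnto Eᗮ
  have : IsProbabilityMeasure (γ.map (fiberProj E)) :=
    Measure.isProbabilityMeasure_map measurable_fiberProj.aemeasurable
  have hfst : (γ.map (fiberProj E)).fst = projMeasure E μ := by
    rw [Measure.fst, Measure.map_map measurable_fst measurable_fiberProj, projMeasure, ← hγ.1.1,
      Measure.map_map hP measurable_fst]
    rfl
  let η := (γ.map (fiberProj E)).condKernel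
  have hη : γ.map (fiberProj E) = projMeasure E μ ⊗ₘ η := by
    rw [← hfst]
    exact ((γ.map (fiberProj E)).disintegrate _).symm
  have hSP : ∀ᵐ p ∂γ, E.orthogonalProjectionOnto p.2 = S (E.orthogonalProjectionOnto p.1) := by
    have h : ∀ᵐ q ∂(projPlan E γ), q.2 = S q.1 := by
      rw [hγ.2]
      exact (ae_map_iff (measurable_id.prodMk hS.1).aemeasurable
        (measurableSet_eq_fun measurable_snd (hS.1.comp measurable_fst))).2
          (Eventually.of_forall fun x => rfl)
    exact ae_of_ae_map measurable_projPlan_map.aemeasurable h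
  have h1 : η.map Prod.fst =ᵐ[projMeasure E μ] κμ := by
    refine Kernel.ae_eq_of_compProd_eq ?_
    rw [Measure.compProd_map measurable_fst, ← hη, ← hκμ.eq_compProd,
      Measure.map_map (by fun_prop) measurable_fiberProj]
    rw [← hγ.1.1]
    rw [Measure.map_map (hP.prodMk hQ) measurable_fst]
    rfl
  -- The second marginal of `γ` only gives the conditional law of the second `Eᗮ`-component given `S
  -- x_E`. Injectivity of `S` on a conull set turns this into conditioning on `x_E`: both joint laws
  -- have image `ν_E ⊗ κν` under `S × id`, which is injective on a conull set.
  have h2 : η.map Prod.snd =ᵐ[projMeasure E μ] κν.comap S hS.1 := by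
    refine Kernel.ae_eq_of_compProd_eq ?_
    obtain ⟨A, hA, hinj⟩ := hS_inj
    obtain ⟨A', hA', hA'm, hA'A⟩ := Eventually.exists_measurable_mem hA
    have hconull : ∀ κ : Kernel E Eᗮ, IsMarkovKernel κ →
        ∀ᵐ p ∂(projMeasure E μ ⊗ₘ κ), p ∈ Prod.fst ⁻¹' A' := by
      intro κ hκ
      refine ae_of_ae_map measurable_fst.aemeasurable (p := fun x => x ∈ A') ?_
      rw [← Measure.fst, Measure.fst_compProd]
      exact hA'
    refine eq_of_map_eq_of_injOn (hS.1.prodMap measurable_id) (measurable_fst hA'm) ?_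
      (hconull _ (Kernel.IsMarkovKernel.map _ measurable_snd)) (hconull _ inferInstance) ?_
    · rintro p hp q hq h
      have h' := Prod.ext_iff.1 h
      exact Prod.ext (hinj (hA'A _ hp) (hA'A _ hq) h'.1) h'.2
    · rw [map_compProd_comap, hS.2, ← hκν.eq_compProd, Measure.compProd_map measurable_snd, ← hη,
        Measure.map_map (by fun_prop) measurable_fiberProj,
        Measure.map_map (hS.1.prodMap measurable_id) ((by fun_prop : Measurable
          (Prod.map id Prod.snd : E × (Eᗮ × Eᗮ) → E × Eᗮ)).comp measurable_fiberProj)]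
      rw [← hγ.1.2]
      rw [Measure.map_map (hP.prodMk hQ) measurable_snd]
      refine Measure.map_congr ?_
      filter_upwards [hSP] with p hp
      simp [fiberProj, hp]
  refine ⟨η, inferInstance, hη, ?_⟩
  filter_upwards [h1, h2] with x hx1 hx2
  rw [Kernel.map_apply _ measurable_fst] at hx1
  rw [Kernel.map_apply _ measurable_snd, Kernel.comap_apply] at hx2
  exact ⟨hx1, hx2⟩

theorem IsMongeKnothePlan.mem_isMinOn [IsProbabilityMeasure μ] [IsProbabilityMeasure ν]
    (hS : IsTransportMap S (projMeasure E μ) (projMeasure E ν))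
    (hS_inj : ∃ A ∈ ae (projMeasure E μ), Set.InjOn S A)
    (hκμ : IsDisintegration E μ κμ) (hκν : IsDisintegration E ν κν)
    {π : Measure (EuclideanSpace ℝ (Fin d) × EuclideanSpace ℝ (Fin d))}
    (hπ : IsMongeKnothePlan E S μ κμ κν π) :
    π ∈ subspaceOptimalPlans E S μ ν ∧
      IsMinOn transportCost (subspaceOptimalPlans E S μ ν) π := by
  obtain ⟨κ, hκ, hopt, rfl⟩ := hπ
  refine ⟨⟨isCoupling_liftPlan hS hκμ hκν κ (hopt.mono fun x hx => hx.1),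
    projPlan_liftPlan hS.1 κ⟩, fun γ hγ => ?_⟩
  obtain ⟨η, hη, hγη, hcoup⟩ :=
    exists_kernel_of_mem_subspaceOptimalPlans hS hS_inj hκμ hκν hγ
  rw [Set.mem_ofPred_eq, transportCost_eq_of_fiberProj hS.1 hγ.2 hγη,
    transportCost_eq_of_fiberProj hS.1 (projPlan_liftPlan hS.1 κ) (map_fiberProj_liftPlan hS.1 κ)]
  refine add_le_add_right (lintegral_mono_ae ?_) _
  filter_upwards [hopt, hcoup] with x hx hxη
  exact hx.2 _ hxη

/-- The plan induced by the Monge-Knothe map is a Monge-Knothe plan. -/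
lemma isMongeKnothePlan_mongeKnotheMap [IsProbabilityMeasure μ] (hS : Measurable S) (hκμ : IsDisintegration E μ κμ)
    {T : E → Eᗮ → Eᗮ} (hT : Measurable fun p : E × Eᗮ => T p.1 p.2)
    (hopt : ∀ᵐ x ∂(projMeasure E μ), IsMongeMap (T x) (κμ x) (κν (S x))) :
    IsMongeKnothePlan E S μ κμ κν (μ.map fun x => (x, mongeKnotheMap E S T x)) := by
  have := isProbabilityMeasure_projMeasure (E := E) μ
  have := hκμ.markov
  have hP := measurable_orthogonalProjectionOnto E
  have hQ := measurable_orthogonalProjectionOnto Eᗮ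
  have hG : Measurable fun p : E × Eᗮ => (p.2, T p.1 p.2) := measurable_snd.prodMk hT
  -- Carrying `x` along through `Kernel.id` lets joint measurability of `T` give measurability of
  -- the fiberwise graph plans.
  let κ : Kernel E (Eᗮ × Eᗮ) := (Kernel.id ×ₖ κμ).map fun p => (p.2, T p.1 p.2)
  have hκ : IsMarkovKernel κ := Kernel.IsMarkovKernel.map _ hG
  have hTx : ∀ x, Measurable fun a => (a, T x a) := fun x =>
    measurable_id.prodMk (hT.comp measurable_prodMk_left)
  have hκx : ∀ x, κ x = (κμ x).map fun a => (a, T x a) := fun x => by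
    rw [Kernel.map_apply _ hG, Kernel.prod_apply, Kernel.id_apply, Measure.dirac_prod,
      Measure.map_map hG measurable_prodMk_left]
    rfl
  refine ⟨κ, hκ, ?_, ?_⟩
  · filter_upwards [hopt] with x hx
    rw [hκx]
    exact hx.2
  · have hcomp : projMeasure E μ ⊗ₘ κ =
        (projMeasure E μ ⊗ₘ κμ).map fun p => (p.1, (p.2, T p.1 p.2)) := by
      refine Measure.ext_of_lintegral _ fun g hg => ?_
      rw [lintegral_map hg (measurable_fst.prodMk hG), Measure.lintegral_compProd hg,
        Measure.lintegral_compProd (f := fun p => g (p.1, p.2, T p.1 p.2))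
          (hg.comp (measurable_fst.prodMk hG))]
      refine lintegral_congr fun x => ?_
      rw [hκx, lintegral_map (f := fun q => g (x, q)) (hg.comp measurable_prodMk_left) (hTx x)]
    rw [liftPlan, hcomp, ← hκμ.eq_compProd,
      Measure.map_map (measurable_fst.prodMk hG) (hP.prodMk hQ),
      Measure.map_map (measurable_liftPlan_map hS)
        ((measurable_fst.prodMk hG).comp (hP.prodMk hQ))]
    congr 1
    funext x
    exact Prod.ext (coe_add_orthogonalProjectionOnto x).symm rfl

/-- Monge-Knothe plans exist. -/
theorem exists_isMongeKnothePlan (hS : Measurable S) (hκμ : IsDisintegration E μ κμ)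
    (hκν : IsDisintegration E ν κν) : ∃ π, IsMongeKnothePlan E S μ κμ κν π := by
  have := hκμ.markov
  have := hκν.markov
  obtain ⟨κ, hκ, hopt⟩ := exists_kernel_isOptimalCoupling κμ (κν.comap S hS)
  exact ⟨_, κ, hκ, Eventually.of_forall hopt, rfl⟩

end Plans

end SubspaceDetour

open SubspaceDetour in
theorem mainTheorem1 {d : ℕ} (E : Submodule ℝ (EuclideanSpace ℝ (Fin d)))
    (μ ν : Measure (EuclideanSpace ℝ (Fin d)))
    [IsProbabilityMeasure μ] [IsProbabilityMeasure ν]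
    (hμ : MemLp (fun x => x) 2 μ) (hν : MemLp (fun x => x) 2 ν)
    (S : E → E) (hS : IsTransportMap S (projMeasure E μ) (projMeasure E ν))
    (hS_inj : ∃ A ∈ ae (projMeasure E μ), Set.InjOn S A)
    (κμ κν : Kernel E Eᗮ) (hκμ : IsDisintegration E μ κμ) (hκν : IsDisintegration E ν κν) :
    (∃ π, IsMongeKnothePlan E S μ κμ κν π) ∧
    (∀ π, IsMongeKnothePlan E S μ κμ κν π →
      π ∈ subspaceOptimalPlans E S μ ν ∧
      IsMinOn transportCost (subspaceOptimalPlans E S μ ν) π ∧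
      transportCost π < ∞) ∧
    (∀ T : E → Eᗮ → Eᗮ, Measurable (fun p : E × Eᗮ => T p.1 p.2) →
      (∀ᵐ x ∂(projMeasure E μ), IsMongeMap (T x) (κμ x) (κν (S x))) →
      μ.map (fun x => (x, mongeKnotheMap E S T x)) ∈ subspaceOptimalPlans E S μ ν ∧
      IsMinOn transportCost (subspaceOptimalPlans E S μ ν)
        (μ.map fun x => (x, mongeKnotheMap E S T x)) ∧
      transportCost (μ.map fun x => (x, mongeKnotheMap E S T x)) < ∞) := by
  have key : ∀ π, IsMongeKnothePlan E S μ κμ κν π →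
      π ∈ subspaceOptimalPlans E S μ ν ∧
      IsMinOn transportCost (subspaceOptimalPlans E S μ ν) π ∧ transportCost π < ∞ := by
    intro π hπ
    obtain ⟨hmem, hmin⟩ := hπ.mem_isMinOn hS hS_inj hκμ hκν
    exact ⟨hmem, hmin, transportCost_lt_top hμ hν hmem.1⟩
  exact ⟨exists_isMongeKnothePlan hS.1 hκμ hκν, key, fun T hT hopt =>
    key _ (isMongeKnothePlan_mongeKnotheMap hS.1 hκμ hT hopt)⟩
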